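/- Let $(z_1,z_2,w)$ be coordinates on $\mathbb{C}^3$, $w=u+iv$, and let $U\subset\mathbb{C}^2_{(z_1,z_2)}$ be a non-empty connected open set on which $1-z_2\bar z_2\neq 0$ (for instance a small ball around the origin). Let $$M_{\mathrm{LC}}:\quad u=\frac{z_1\bar z_1+\frac12 z_1^2\bar z_2+\frac12\bar z_1^2z_2}{1-z_2\bar z_2},\qquad (z_1,z_2)\in U,$$ and let $\mathfrak{hol}_{\mathrm{rigid}}(M_{\mathrm{LC}})$ be the set of infinitesimal rigid biholomorphisms of $M_{\mathrm{LC}}$, that is, of the holomorphic vector fields on $U\times\mathbb{C}$ of the form $$X=A_1(z_1,z_2)\,\partial_{z_1}+A_2(z_1,z_2)\,\partial_{z_2}+\big(\alpha w+B(z_1,z_2)\big)\,\partial_w,$$ with $A_1,A_2,B$ holomorphic on $U$ and $\alpha\in\mathbb{R}$, such that $X+\overline X$ is tangent to $M_{\mathrm{LC}}$ at every point of $M_{\mathrm{LC}}$. Then $\mathfrak{hol}_{\mathrm{rigid}}(M_{\mathrm{LC}})$ is a real Lie algebra under the Lie bracket of vector fields, it has real dimension exactly $7$, and the (restrictions to $U\times\mathbb{C}$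 of the) following seven fields are linearly independent over $\mathbb{R}$ and span it over $\mathbb{R}$: $$\begin{aligned} X^1&=i\,\partial_w,\\ X^2&=z_1\partial_{z_1}+2w\,\partial_w,\\ X^3&=iz_1\partial_{z_1}+2iz_2\partial_{z_2},\\ X^4&=(z_2-1)\partial_{z_1}-2z_1\partial_w,\\ X^5&=(i+iz_2)\partial_{z_1}-2iz_1\partial_w,\\ X^6&=z_1z_2\partial_{z_1}+(z_2^2-1)\partial_{z_2}-z_1^2\partial_w,\\ X^7&=iz_1z_2\partial_{z_1}+(iz_2^2+i)\partial_{z_2}-iz_1^2\partial_w. \end{aligned}$$ -/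

import Mathlib

open TopologicalSpace ComplexConjugate

noncomputable section

namespace RigidCR

/-- `ℂ³` with coordinates `(z₁, z₂, w)`: a point `p` has `p.1 = (z₁, z₂)` and `p.2 = w`. -/
abbrev C3 : Type := (ℂ × ℂ) × ℂ

/-- The real vector space of holomorphic vector fields
`X = X₁ ∂_{z₁} + X₂ ∂_{z₂} + X₃ ∂_w` on an open set `Ω ⊆ ℂ³`. Such a field is recorded by its
coefficient vector `p ↦ ((X₁ p, X₂ p), X₃ p)`, extended by `0` outside `Ω`, so that two fields are
equal precisely when they agree on `Ω`. -/
def HolVF (Ω : Opens C3) : Submodule ℝ (C3 → C3) where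
  carrier := {X | AnalyticOnNhd ℂ X Ω ∧ ∀ p ∉ Ω, X p = 0}
  zero_mem' := ⟨analyticOnNhd_const, fun _ _ => rfl⟩
  add_mem' := fun {X Y} hX hY =>
    ⟨hX.1.add hY.1, fun p hp => by simp [hX.2 p hp, hY.2 p hp]⟩
  smul_mem' := fun c X hX =>
    ⟨fun p hp => by
      have h : AnalyticAt ℂ ((c : ℂ) • X) p := (hX.1 p hp).const_smul
      refine h.congr (Filter.Eventually.of_forall fun q => ?_)
      simp,
     fun p hp => by simp [hX.2 p hp]⟩

namespace HolVF

variable {Ω : Opens C3}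

theorem analyticAt_coe (X : HolVF Ω) {p : C3} (hp : p ∈ Ω) : AnalyticAt ℂ X.1 p := X.2.1 p hp

theorem differentiableAt_coe (X : HolVF Ω) {p : C3} (hp : p ∈ Ω) : DifferentiableAt ℂ X.1 p :=
  (analyticAt_coe X hp).differentiableAt

theorem ext_on {X Y : HolVF Ω} (h : ∀ p ∈ Ω, X.1 p = Y.1 p) : X = Y := by
  apply Subtype.ext
  funext p
  by_cases hp : p ∈ Ω
  · exact h p hp
  · rw [X.2.2 p hp, Y.2.2 p hp]

/-- A field given on `Ω` by a formula that is holomorphic on `Ω`. -/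
def mk (Ω : Opens C3) (X : C3 → C3) (hX : AnalyticOnNhd ℂ X Ω) : HolVF Ω :=
  ⟨(Ω : Set C3).indicator X,
    fun p hp => (hX p hp).congr (by
      filter_upwards [Ω.isOpen.mem_nhds hp] with q hq
      exact (Set.indicator_of_mem hq X).symm),
    fun _ hp => Set.indicator_of_notMem hp X⟩

theorem mk_apply {X : C3 → C3} {hX : AnalyticOnNhd ℂ X Ω} {p : C3} (hp : p ∈ Ω) :
    (mk Ω X hX).1 p = X p := Set.indicator_of_mem hp X

theorem mk_eventuallyEq {X : C3 → C3} {hX : AnalyticOnNhd ℂ X Ω} {p : C3} (hp : p ∈ Ω) :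
    (mk Ω X hX).1 =ᶠ[nhds p] X := by
  filter_upwards [Ω.isOpen.mem_nhds hp] with q hq
  exact mk_apply hq

theorem analyticOnNhd_lieBracket (X Y : HolVF Ω) :
    AnalyticOnNhd ℂ (VectorField.lieBracket ℂ X.1 Y.1) Ω := fun p hp => by
  have hX := (analyticAt_coe X hp).contDiffAt (n := ⊤)
  have hY := (analyticAt_coe Y hp).contDiffAt (n := ⊤)
  exact (hX.lieBracket_vectorField hY (m := ⊤) (by simp)).analyticAt

/-- The Lie bracket of vector fields. -/
instance : Bracket (HolVF Ω) (HolVF Ω) where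
  bracket X Y := mk Ω (VectorField.lieBracket ℂ X.1 Y.1) (analyticOnNhd_lieBracket X Y)

theorem bracket_apply (X Y : HolVF Ω) {p : C3} (hp : p ∈ Ω) :
    (⁅X, Y⁆ : HolVF Ω).1 p = VectorField.lieBracket ℂ X.1 Y.1 p := mk_apply hp

theorem bracket_eventuallyEq (X Y : HolVF Ω) {p : C3} (hp : p ∈ Ω) :
    (⁅X, Y⁆ : HolVF Ω).1 =ᶠ[nhds p] VectorField.lieBracket ℂ X.1 Y.1 := mk_eventuallyEq hp

instance : LieRing (HolVF Ω) where
  add_lie X Y Z := ext_on fun p hp => by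
    rw [bracket_apply _ _ hp, Submodule.coe_add, Submodule.coe_add, Pi.add_apply,
      bracket_apply _ _ hp, bracket_apply _ _ hp,
      VectorField.lieBracket_add_left (differentiableAt_coe X hp) (differentiableAt_coe Y hp)]
  lie_add X Y Z := ext_on fun p hp => by
    rw [bracket_apply _ _ hp, Submodule.coe_add, Submodule.coe_add, Pi.add_apply,
      bracket_apply _ _ hp, bracket_apply _ _ hp,
      VectorField.lieBracket_add_right (differentiableAt_coe Y hp) (differentiableAt_coe Z hp)]
  lie_self X := ext_on fun p hp => by
    rw [bracket_apply _ _ hp, VectorField.lieBracket_self]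
    rfl
  leibniz_lie X Y Z := ext_on fun p hp => by
    rw [bracket_apply _ _ hp, Submodule.coe_add, Pi.add_apply,
      bracket_apply _ _ hp, bracket_apply _ _ hp,
      (Filter.EventuallyEq.refl _ X.1).lieBracket_vectorField_eq (bracket_eventuallyEq Y Z hp),
      (bracket_eventuallyEq X Y hp).lieBracket_vectorField_eq (Filter.EventuallyEq.refl _ Z.1),
      (Filter.EventuallyEq.refl _ Y.1).lieBracket_vectorField_eq (bracket_eventuallyEq X Z hp)]
    exact VectorField.leibniz_identity_lieBracket (n := 2) (by simp)
      (analyticAt_coe X hp).contDiffAt (analyticAt_coe Y hp).contDiffAt (analyticAt_coe Z hp).contDiffAt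

instance : LieAlgebra ℝ (HolVF Ω) where
  lie_smul c X Y := ext_on fun p hp => by
    have hc : ((c • Y : HolVF Ω) : C3 → C3) = (c : ℂ) • Y.1 := by
      funext q
      simp
    rw [bracket_apply _ _ hp, hc, VectorField.lieBracket_const_smul_right (differentiableAt_coe Y hp),
      Submodule.coe_smul, Pi.smul_apply, bracket_apply _ _ hp]
    simp

end HolVF

/-- The open cylinder `U × ℂ_w` over an open set `U ⊆ ℂ²`. -/
def cylinder (U : Opens (ℂ × ℂ)) : Opens C3 :=
  ⟨(U : Set (ℂ × ℂ)) ×ˢ Set.univ, U.isOpen.prod isOpen_univ⟩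

/-- The rigid hypersurface `u = F(z₁, z₂, z̄₁, z̄₂)`, `w = u + i v`, over `U`. -/
def rigidHypersurface (U : Opens (ℂ × ℂ)) (F : ℂ × ℂ → ℝ) : Set C3 :=
  {p | p.1 ∈ U ∧ p.2.re = F p.1}

/-- The real tangent space at `p` of `u = F`: the kernel of the real differential of the defining
function `u - F`. -/
def tangentSpaceAt (F : ℂ × ℂ → ℝ) (p : C3) : Submodule ℝ C3 :=
  LinearMap.ker (fderiv ℝ (fun q : C3 => q.2.re - F q.1) p : C3 →L[ℝ] ℝ).toLinearMap

/-- The infinitesimal rigid biholomorphisms of `M = {u = F}` over `U`: holomorphic fields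
`X = A₁(z) ∂_{z₁} + A₂(z) ∂_{z₂} + (α w + B(z)) ∂_w` with `A₁, A₂, B` holomorphic on `U` and
`α` real, such that `X + X̄` is tangent to `M`. For a complex coefficient `a = a' + i a''` one has
`a ∂_z + ā ∂_{z̄} = a' ∂_x + a'' ∂_y`, so under `ℂ³ = ℝ⁶` the real vector `(X + X̄)(p)` is just
the coefficient vector `X p`. -/
def holRigid (U : Opens (ℂ × ℂ)) (F : ℂ × ℂ → ℝ) : Set (HolVF (cylinder U)) :=
  {X | (∃ (A₁ A₂ B : ℂ × ℂ → ℂ) (α : ℝ),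
          AnalyticOnNhd ℂ A₁ U ∧ AnalyticOnNhd ℂ A₂ U ∧ AnalyticOnNhd ℂ B U ∧
          ∀ p ∈ cylinder U, X.1 p = ((A₁ p.1, A₂ p.1), (α : ℂ) * p.2 + B p.1)) ∧
        ∀ p ∈ rigidHypersurface U F, X.1 p ∈ tangentSpaceAt F p}

/-- The right-hand side of the equation of the model, as a complex number. -/
def modelC (z : ℂ × ℂ) : ℂ :=
  (z.1 * conj z.1 + (1 / 2) * z.1 ^ 2 * conj z.2 + (1 / 2) * (conj z.1) ^ 2 * z.2) /
    (1 - z.2 * conj z.2)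

/-- The graphing function of the model. -/
def modelF (z : ℂ × ℂ) : ℝ := (modelC z).re

/-- The right-hand side is real, so that taking its real part loses nothing. -/
theorem modelF_eq (z : ℂ × ℂ) : (modelF z : ℂ) = modelC z := by
  refine Complex.conj_eq_iff_re.mp ?_
  simp only [modelC, map_div₀, map_add, map_sub, map_mul, map_pow, map_one, map_ofNat,
    Complex.conj_conj]
  congr 1 <;> ring

/-- The coefficients of the seven fields `X¹, …, X⁷` at `p = ((z₁, z₂), w)`. -/
def modelCoeff : Fin 7 → C3 → C3 := fun i p =>
  let z₁ := p.1.1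
  let z₂ := p.1.2
  let w := p.2
  let I := Complex.I
  ![((0, 0), I),
    ((z₁, 0), 2 * w),
    ((I * z₁, 2 * I * z₂), 0),
    ((z₂ - 1, 0), -2 * z₁),
    ((I + I * z₂, 0), -2 * I * z₁),
    ((z₁ * z₂, z₂ ^ 2 - 1), -z₁ ^ 2),
    ((I * z₁ * z₂, I * z₂ ^ 2 + I), -I * z₁ ^ 2)] i

theorem analyticOnNhd_modelCoeff (i : Fin 7) (s : Set C3) : AnalyticOnNhd ℂ (modelCoeff i) s := by
  have h : ContDiff ℂ ⊤ (modelCoeff i) := by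
    unfold modelCoeff
    fin_cases i <;> simp <;> fun_prop
  exact fun p _ => h.contDiffAt.analyticAt

/-- The seven fields `X¹, …, X⁷`, restricted to `U × ℂ_w`. -/
def modelField (U : Opens (ℂ × ℂ)) (i : Fin 7) : HolVF (cylinder U) :=
  HolVF.mk (cylinder U) (modelCoeff i) (analyticOnNhd_modelCoeff i _)

end RigidCR

end

noncomputable section

namespace RigidCR

open scoped Topology

/-! ### Vanishing of polynomials on neighbourhoods -/

/-! Put `p = ∂F/∂z₁` (`slope`). Everything rests on three identities: `∂F/∂z₂ = p²/2`, `conj p = z₁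
+ z₂ p` and `F = Re (z₁ p)`. With `a = 2 A₁ - α z₁`, which absorbs the term `α w`, tangency becomes
`Re (a p + A₂ p² - B) = 0` on `U`.

The identity `∂F/∂z₂ = p²/2` makes the Levi form degenerate, with kernel spanned by `(-p, 1)`. After
polarization, moving `z` in this direction with the conjugate variables frozen changes neither `p`
nor its conjugate counterpart, so `a p + A₂ p² - B` is constant along the motion. Differentiating
gives a cubic in `p` whose coefficients depend on `z` alone, while `p` fills an open set. Its four
coefficients vanish: `B_{z₂} = 0`, `a_{z₂} = -B_{z₁}`, `(A₂)_{z₂} = a_{z₁}`, `(A₂)_{z₁} = 0`. On a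
connected `U` the solutions are polynomials with six complex parameters.

Substituting `z₁ = conj p - z₂ p` back into the real equation leaves a real quadratic in `p`; its
vanishing cuts these down to six real parameters, and `α` is the seventh. Conversely every
combination of the seven fields is tangent, and an explicit formula for the brackets shows that
their span is closed. -/

theorem polynomial_eq_zero_of_eventually {𝕜 : Type*} [NontriviallyNormedField 𝕜]
    {p : Polynomial 𝕜} {x : 𝕜} (h : ∀ᶠ t in 𝓝 x, p.eval t = 0) : p = 0 :=
  Polynomial.eq_zero_of_infinite_isRoot p (infinite_of_mem_nhds x h)

theorem cubic_coeffs_eq_zero {𝕜 : Type*} [NontriviallyNormedField 𝕜] {c₀ c₁ c₂ c₃ x : 𝕜}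
    (h : ∀ᶠ t in 𝓝 x, c₀ + c₁ * t + c₂ * t ^ 2 + c₃ * t ^ 3 = 0) :
    c₀ = 0 ∧ c₁ = 0 ∧ c₂ = 0 ∧ c₃ = 0 := by
  have hp : (Polynomial.C c₀ + Polynomial.C c₁ * Polynomial.X + Polynomial.C c₂ * Polynomial.X ^ 2
      + Polynomial.C c₃ * Polynomial.X ^ 3 : Polynomial 𝕜) = 0 :=
    polynomial_eq_zero_of_eventually (x := x) (by simpa using h)
  have hc := fun n => congrArg (fun p => Polynomial.coeff p n) hp
  refine ⟨?_, ?_, ?_, ?_⟩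
  · simpa [Polynomial.coeff_X, Polynomial.coeff_C] using hc 0
  · simpa [Polynomial.coeff_X, Polynomial.coeff_C] using hc 1
  · simpa [Polynomial.coeff_X, Polynomial.coeff_C] using hc 2
  · simpa [Polynomial.coeff_X, Polynomial.coeff_C] using hc 3

theorem quadratic_coeffs_eq_zero {𝕜 : Type*} [NontriviallyNormedField 𝕜] {c₀ c₁ c₂ x : 𝕜}
    (h : ∀ᶠ t in 𝓝 x, c₀ + c₁ * t + c₂ * t ^ 2 = 0) : c₀ = 0 ∧ c₁ = 0 ∧ c₂ = 0 := by
  obtain ⟨h₀, h₁, h₂, -⟩ := cubic_coeffs_eq_zero (c₃ := 0) (x := x) (by simpa using h)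
  exact ⟨h₀, h₁, h₂⟩

/-- A real quadratic polynomial on `ℂ` that vanishes on a neighbourhood is zero. -/
theorem real_quadratic_coeffs_eq_zero {b n m : ℂ} {c : ℂ} {x : ℂ}
    (h : ∀ᶠ p in 𝓝 x, (b + n * p + c * (p * conj p) + m * p ^ 2).re = 0) :
    b.re = 0 ∧ n = 0 ∧ c.re = 0 ∧ m = 0 := by
  -- Restrict to real lines through `x`. The second-order terms in the directions `1`, `I`, `1 + I`
  -- determine `c.re` and `m`; the first-order terms then determine `n`.
  have key : ∀ v : ℂ, (n * v + c * (x * conj v + v * conj x) + 2 * m * x * v).re = 0 ∧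
      (c * (v * conj v) + m * v ^ 2).re = 0 := by
    intro v
    have hline : Filter.Tendsto (fun t : ℝ => x + t * v) (𝓝 0) (𝓝 x) := by
      have : Continuous (fun t : ℝ => x + t * v) := by fun_prop
      simpa using this.tendsto 0
    have := quadratic_coeffs_eq_zero (𝕜 := ℝ) (x := 0)
      (c₀ := (b + n * x + c * (x * conj x) + m * x ^ 2).re)
      (c₁ := (n * v + c * (x * conj v + v * conj x) + 2 * m * x * v).re)
      (c₂ := (c * (v * conj v) + m * v ^ 2).re) (by
        filter_upwards [hline.eventually h] with t ht
        rw [← ht]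
        simp [pow_two]
        ring)
    exact ⟨this.2.1, this.2.2⟩
  have h0 := h.self_of_nhds
  have q1 := (key 1).2
  have qI := (key Complex.I).2
  have q1I := (key (1 + Complex.I)).2
  have l1 := (key 1).1
  have lI := (key Complex.I).1
  simp [pow_two] at q1 qI q1I
  have hc : c.re = 0 := by linarith
  have hmr : m.re = 0 := by linarith
  have hmi : m.im = 0 := by linarith
  have hm : m = 0 := Complex.ext hmr hmi
  simp [hm, hc] at l1 lI
  have hn : n = 0 := Complex.ext (by simpa using l1) (by simpa using lI)
  simp [hm, hn, hc] at h0
  exact ⟨by linear_combination h0, hn, hc, hm⟩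

/-! ### Polarization -/

/-- Polarization: a sesqui-holomorphic function of two points that vanishes on the diagonal
vanishes identically. -/
theorem polarization {E : Type*} [NormedAddCommGroup E] [NormedSpace ℂ E] {V : Set E}
    (hV : IsOpen V) (hconv : Convex ℝ V) {S : E → E → ℂ}
    (hS : ∀ (r s : E) (t : ℂ), r + t • s ∈ V → r + conj t • s ∈ V →
      DifferentiableAt ℂ (fun t : ℂ => S (r + t • s) (r + conj t • s)) t)
    (hdiag : ∀ z ∈ V, S z z + conj (S z z) = 0) {z y : E} (hz : z ∈ V) (hy : y ∈ V) :
    S z y + conj (S y z) = 0 := by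
  -- Chosen so that `t = I` gives the pair `(z, y)`, `t = -I` the pair `(y, z)`, and real `t` a
  -- point of the diagonal.
  set r : E := (1 / 2 : ℂ) • (z + y) with hr
  set s : E := (-Complex.I / 2) • (z - y) with hs
  have hrz : r + Complex.I • s = z := by
    rw [hr, hs, smul_smul, show Complex.I * (-Complex.I / 2) = 1 / 2 by
      rw [mul_div_assoc', mul_neg, Complex.I_mul_I, neg_neg]]
    rw [← smul_add, show z + y + (z - y) = (2 : ℂ) • z by rw [two_smul]; abel, smul_smul]
    norm_num
  have hry : r + conj Complex.I • s = y := by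
    rw [Complex.conj_I, neg_smul, hr, hs, smul_smul, show Complex.I * (-Complex.I / 2) = 1 / 2 by
      rw [mul_div_assoc', mul_neg, Complex.I_mul_I, neg_neg]]
    rw [← sub_eq_add_neg, ← smul_sub, show z + y - (z - y) = (2 : ℂ) • y by rw [two_smul]; abel,
      smul_smul]
    norm_num
  set D : Set ℂ := {t | r + t • s ∈ V ∧ r + conj t • s ∈ V} with hD
  have hDopen : IsOpen D := by
    refine (hV.preimage (f := fun t : ℂ => r + t • s) (by fun_prop)).inter
      (hV.preimage (f := fun t : ℂ => r + conj t • s) ?_)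
    exact continuous_const.add (Complex.continuous_conj.smul continuous_const)
  have hDconv : Convex ℝ D := by
    rintro t ⟨h1, h2⟩ t' ⟨h1', h2'⟩ α β hα hβ hαβ
    have e : ∀ u v : ℂ, r + (α • u + β • v) • s = α • (r + u • s) + β • (r + v • s) := by
      intro u v
      have : α • r + β • r = r := by rw [← add_smul, hαβ, one_smul]
      rw [smul_add, smul_add, add_smul, smul_assoc, smul_assoc]
      nth_rewrite 1 [← this]
      abel
    refine ⟨?_, ?_⟩
    · rw [e]
      exact hconv h1 h1' hα hβ hαβ
    · have : conj (α • t + β • t') = α • conj t + β • conj t' := by simp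
      rw [this, e]
      exact hconv h2 h2' hα hβ hαβ
  have hI : Complex.I ∈ D := ⟨by rwa [hrz], by rwa [hry]⟩
  have hI' : -Complex.I ∈ D := by
    refine ⟨?_, ?_⟩
    · rwa [← Complex.conj_I, hry]
    · rwa [map_neg, Complex.conj_I, neg_neg, hrz]
  have h0 : (0 : ℂ) ∈ D := by
    have := hDconv hI hI' (a := 1 / 2) (b := 1 / 2) (by norm_num) (by norm_num) (by norm_num)
    simpa using this
  set f : ℂ → ℂ := fun t => S (r + t • s) (r + conj t • s) with hf
  set g : ℂ → ℂ := fun t => f t + conj (f (conj t)) with hg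
  have hgd : DifferentiableOn ℂ g D := by
    intro t ht
    refine DifferentiableAt.differentiableWithinAt ?_
    refine (hS r s t ht.1 ht.2).add ?_
    have h2 : DifferentiableAt ℂ f (conj t) := hS r s (conj t) ht.2 (by simpa using ht.1)
    have := h2.conj_conj
    simpa [Function.comp_def] using this
  have hreal : ∀ᶠ t : ℝ in 𝓝 (0 : ℝ), g t = 0 := by
    have hc : Filter.Tendsto (fun t : ℝ => (t : ℂ)) (𝓝 0) (𝓝 0) := by
      simpa using Complex.continuous_ofReal.tendsto 0
    filter_upwards [hc.eventually (hDopen.mem_nhds h0)] with t ht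
    simp only [hg, hf, Complex.conj_ofReal]
    exact hdiag _ ht.1
  -- The real axis, where `g` vanishes by `hdiag`, accumulates at `0`; the identity theorem on the
  -- convex set `D` carries this to `t = I`.
  have hfreq : ∃ᶠ t in 𝓝[≠] (0 : ℂ), g t = 0 := by
    have hc : Filter.Tendsto (fun t : ℝ => (t : ℂ)) (𝓝[≠] 0) (𝓝[≠] 0) := by
      refine tendsto_nhdsWithin_iff.2 ⟨?_, ?_⟩
      · have := Complex.continuous_ofReal.tendsto 0
        simp only [Complex.ofReal_zero] at this
        exact this.mono_left nhdsWithin_le_nhds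
      · filter_upwards [self_mem_nhdsWithin] with t ht
        simpa using ht
    exact hc.frequently (hreal.filter_mono nhdsWithin_le_nhds).frequently
  have := (hgd.analyticOnNhd hDopen).eqOn_zero_of_preconnected_of_frequently_eq_zero
    hDconv.isPreconnected h0 hfreq hI
  simpa only [hg, hf, hrz, hry, Complex.conj_conj, Pi.zero_apply] using this

/-! ### The graphing function -/

/-- The derivative `∂F/∂z₁` of the graphing function of the model. -/
def slope (z : ℂ × ℂ) : ℂ := (conj z.1 + z.1 * conj z.2) / (1 - z.2 * conj z.2)

theorem conj_slope {z : ℂ × ℂ} (hz : 1 - z.2 * conj z.2 ≠ 0) :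
    conj (slope z) = z.1 + z.2 * slope z := by
  have h' : 1 - conj z.2 * z.2 ≠ 0 := by rwa [mul_comm]
  simp only [slope, map_div₀, map_add, map_sub, map_mul, map_one, Complex.conj_conj]
  field_simp
  ring

/-- `slope` restricted to a complex line `z₂ = const` is a real-linear bijection. -/
theorem slope_of_conj_sub {p z₂ : ℂ} (hz : 1 - z₂ * conj z₂ ≠ 0) :
    slope (conj p - z₂ * p, z₂) = p := by
  simp only [slope, map_sub, map_mul, Complex.conj_conj]
  rw [div_eq_iff hz]
  ring

/-- Euler's identity: `F` is homogeneous of degree 2 in `(z₁, conj z₁)`, so `2F = z₁ p + conj (z₁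
p)`. -/
theorem modelF_eq_re {z : ℂ × ℂ} (hz : 1 - z.2 * conj z.2 ≠ 0) :
    modelF z = (z.1 * slope z).re := by
  have h' : 1 - conj z.2 * z.2 ≠ 0 := by rwa [mul_comm]
  have h := modelF_eq z
  have hs : modelC z = (z.1 * slope z + conj (z.1 * slope z)) / 2 := by
    rw [map_mul, conj_slope hz]
    simp only [modelC, slope]
    field_simp
    ring
  rw [Complex.add_conj] at hs
  rw [hs] at h
  push_cast at h
  rw [mul_div_cancel_left₀ _ (two_ne_zero)] at h
  exact_mod_cast h

theorem differentiableAt_modelC {z : ℂ × ℂ} (hz : 1 - z.2 * conj z.2 ≠ 0) :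
    DifferentiableAt ℝ modelC z := by
  have h1 : DifferentiableAt ℝ (fun z : ℂ × ℂ => conj z.1) z :=
    Complex.conjCLE.differentiable.differentiableAt.comp z differentiableAt_fst
  have h2 : DifferentiableAt ℝ (fun z : ℂ × ℂ => conj z.2) z :=
    Complex.conjCLE.differentiable.differentiableAt.comp z differentiableAt_snd
  have d1 : DifferentiableAt ℝ (fun z : ℂ × ℂ => z.1) z := differentiableAt_fst
  have d2 : DifferentiableAt ℝ (fun z : ℂ × ℂ => z.2) z := differentiableAt_snd
  have hN := ((d1.mul h1).add (((d1.pow 2).const_mul (1 / 2 : ℂ)).mul h2)).add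
    (((h1.pow 2).const_mul (1 / 2 : ℂ)).mul d2)
  have hD := (d2.mul h2).const_sub (1 : ℂ)
  have h := hN.mul ((hasFDerivAt_inv' (𝕜 := ℝ) hz).differentiableAt.comp z hD)
  exact h.congr_of_eventuallyEq (Filter.Eventually.of_forall fun z => by
    simp [modelC, div_eq_mul_inv])

/-- The two holomorphic partial derivatives of `F` are `p` and `p² / 2`, and a real function has
differential `2 Re (∂F)`. -/
theorem hasLineDerivAt_modelC {z : ℂ × ℂ} (hz : 1 - z.2 * conj z.2 ≠ 0) (v : ℂ × ℂ) :
    HasLineDerivAt ℝ modelC ((2 * slope z * v.1 + slope z ^ 2 * v.2).re : ℂ) z v := by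
  have hline : ∀ c d : ℂ, HasDerivAt (fun t : ℝ => c + t * d) d 0 := fun c d => by
    simpa using ((Complex.ofRealCLM.hasDerivAt (x := (0 : ℝ))).mul_const d).const_add c
  have a1 := hline z.1 v.1
  have a2 := hline z.2 v.2
  have b1 := hline (conj z.1) (conj v.1)
  have b2 := hline (conj z.2) (conj v.2)
  have hN := ((a1.mul b1).add (((a1.pow 2).const_mul (1 / 2 : ℂ)).mul b2)).add
    (((b1.pow 2).const_mul (1 / 2 : ℂ)).mul a2)
  have hD := (a2.mul b2).const_sub (1 : ℂ)
  have h := hN.div hD (by simpa using hz)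
  unfold HasLineDerivAt
  refine (h.congr_deriv ?_).congr_of_eventuallyEq (Filter.Eventually.of_forall fun t => ?_)
  · rw [← mul_left_inj' (two_ne_zero (α := ℂ)), mul_comm _ (2 : ℂ), mul_comm _ (2 : ℂ)]
    have e := Complex.add_conj (2 * slope z * v.1 + slope z ^ 2 * v.2)
    push_cast at e
    rw [← e]
    simp only [map_add, map_mul, map_pow, map_ofNat, conj_slope hz, Pi.add_apply, Pi.mul_apply,
      Pi.pow_apply]
    have h' : 1 - conj z.2 * z.2 ≠ 0 := by rwa [mul_comm]
    simp only [slope]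
    simp
    field_simp
    ring
  · simp [modelC]

/-- The tangent space of the model in terms of the slope function. -/
theorem mem_tangentSpaceAt_iff {p : C3} (hp : 1 - p.1.2 * conj p.1.2 ≠ 0) (v : C3) :
    v ∈ tangentSpaceAt modelF p ↔
      v.2.re = (2 * slope p.1 * v.1.1 + slope p.1 ^ 2 * v.1.2).re := by
  have hC := differentiableAt_modelC hp
  have hF : HasFDerivAt modelF (Complex.reCLM.comp (fderiv ℝ modelC p.1)) p.1 :=
    Complex.reCLM.hasFDerivAt.comp p.1 hC.hasFDerivAt
  have hu : HasFDerivAt (fun q : C3 => q.2.re) (Complex.reCLM.comp (ContinuousLinearMap.snd ℝ _ _)) p :=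
    (Complex.reCLM.comp (ContinuousLinearMap.snd ℝ (ℂ × ℂ) ℂ)).hasFDerivAt
  have h := hu.sub (hF.comp p hasFDerivAt_fst)
  have hl : fderiv ℝ modelC p.1 v.1 = _ :=
    hC.lineDeriv_eq_fderiv.symm.trans (hasLineDerivAt_modelC hp v.1).lineDeriv
  have h' : fderiv ℝ (fun q : C3 => q.2.re - modelF q.1) p = _ := h.fderiv
  unfold tangentSpaceAt
  rw [LinearMap.mem_ker, h']
  simp [hl, sub_eq_zero]

/-! ### The differential system -/

section System

variable {U : Opens (ℂ × ℂ)} {a A B : ℂ × ℂ → ℂ}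

/-- The polarized form of the tangency equation, without denominators. -/
def polarForm (a A B : ℂ × ℂ → ℂ) (z y : ℂ × ℂ) : ℂ :=
  a z * (conj y.1 + z.1 * conj y.2) * (1 - z.2 * conj y.2) +
    A z * (conj y.1 + z.1 * conj y.2) ^ 2 - B z * (1 - z.2 * conj y.2) ^ 2

/-- The second point enters `polarForm` only through its conjugate, and conjugating `r + conj t • s`
gives an expression holomorphic in `t`. -/
theorem differentiableAt_polarForm (ha : AnalyticOnNhd ℂ a U) (hA : AnalyticOnNhd ℂ A U)
    (hB : AnalyticOnNhd ℂ B U) (r s : ℂ × ℂ) {t : ℂ} (ht : r + t • s ∈ U) :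
    DifferentiableAt ℂ (fun t : ℂ => polarForm a A B (r + t • s) (r + conj t • s)) t := by
  have hl : DifferentiableAt ℂ (fun t : ℂ => r + t • s) t := by fun_prop
  have h1 : DifferentiableAt ℂ (fun t : ℂ => a (r + t • s)) t :=
    (ha _ ht).differentiableAt.comp t hl
  have h2 : DifferentiableAt ℂ (fun t : ℂ => A (r + t • s)) t :=
    (hA _ ht).differentiableAt.comp t hl
  have h3 : DifferentiableAt ℂ (fun t : ℂ => B (r + t • s)) t :=
    (hB _ ht).differentiableAt.comp t hl
  simp only [polarForm, Prod.fst_add, Prod.snd_add, Prod.smul_fst, Prod.smul_snd, map_add,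
    smul_eq_mul, map_mul, Complex.conj_conj]
  generalize conj r.1 = r₁, conj r.2 = r₂, conj s.1 = s₁, conj s.2 = s₂
  have hN : DifferentiableAt ℂ
      (fun t : ℂ => r₁ + t * s₁ + (r.1 + t * s.1) * (r₂ + t * s₂)) t := by fun_prop
  have hD : DifferentiableAt ℂ (fun t : ℂ => 1 - (r.2 + t * s.2) * (r₂ + t * s₂)) t := by
    fun_prop
  exact (((h1.mul hN).mul hD).add (h2.mul (hN.pow 2))).sub (h3.mul (hD.pow 2))

theorem polarForm_add_conj_eq_zero (hdom : ∀ z ∈ U, 1 - z.2 * conj z.2 ≠ 0)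
    (ha : AnalyticOnNhd ℂ a U) (hA : AnalyticOnNhd ℂ A U) (hB : AnalyticOnNhd ℂ B U)
    (htan : ∀ z ∈ U, (a z * slope z + A z * slope z ^ 2 - B z).re = 0)
    {V : Set (ℂ × ℂ)} (hV : IsOpen V) (hconv : Convex ℝ V) (hVU : V ⊆ U)
    {z y : ℂ × ℂ} (hz : z ∈ V) (hy : y ∈ V) :
    polarForm a A B z y + conj (polarForm a A B y z) = 0 := by
  refine polarization hV hconv (S := polarForm a A B)
    (fun r s t ht _ => differentiableAt_polarForm ha hA hB r s (hVU ht)) (fun z hz => ?_) hz hy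
  have hd := hdom z (hVU hz)
  -- On the diagonal the cleared denominator is the square of a real number, so the factor is real
  -- and passes through the real part.
  have e : polarForm a A B z z =
      ((Complex.normSq (1 - z.2 * conj z.2) : ℝ) : ℂ) *
        (a z * slope z + A z * slope z ^ 2 - B z) := by
    have h' : 1 - conj z.2 * z.2 ≠ 0 := by rwa [mul_comm]
    rw [Complex.normSq_eq_conj_mul_self]
    simp only [polarForm, slope, map_sub, map_mul, map_one, Complex.conj_conj]
    field_simp
  rw [Complex.add_conj, e, Complex.re_ofReal_mul, htan z (hVU hz)]
  simp

theorem fderiv_prod_apply {f : ℂ × ℂ → ℂ} {z : ℂ × ℂ} (x y : ℂ) :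
    fderiv ℂ f z (x, y) = x * fderiv ℂ f z (1, 0) + y * fderiv ℂ f z (0, 1) := by
  have : ((x, y) : ℂ × ℂ) = x • ((1, 0) : ℂ × ℂ) + y • ((0, 1) : ℂ × ℂ) := by simp
  rw [this, map_add, map_smul, map_smul, smul_eq_mul, smul_eq_mul]

/-- Moving `z` in the direction `(-p, 1)` of the Levi kernel. -/
theorem levi_kernel_equation (hdom : ∀ z ∈ U, 1 - z.2 * conj z.2 ≠ 0)
    (ha : AnalyticOnNhd ℂ a U) (hA : AnalyticOnNhd ℂ A U) (hB : AnalyticOnNhd ℂ B U)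
    (htan : ∀ z ∈ U, (a z * slope z + A z * slope z ^ 2 - B z).re = 0)
    {z : ℂ × ℂ} (hz : z ∈ U) :
    ∀ᶠ p in 𝓝 (slope z), fderiv ℂ a z (-p, 1) * p + fderiv ℂ A z (-p, 1) * p ^ 2
      - fderiv ℂ B z (-p, 1) = 0 := by
  obtain ⟨ε, hε, hball⟩ := Metric.isOpen_iff.1 U.isOpen z hz
  have hd := hdom z hz
  set d : ℂ := 1 - z.2 * conj z.2 with hdd
  -- The point `y` has `y₂ = z₂`, and its first coordinate is solved for so that the polarized slope
  -- at `(z, y)` equals the prescribed `p`.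
  have hcont : Filter.Tendsto (fun p : ℂ => ((conj (p * d - z.1 * conj z.2), z.2) : ℂ × ℂ))
      (𝓝 (slope z)) (𝓝 z) := by
    have hc : Continuous (fun p : ℂ => ((conj (p * d - z.1 * conj z.2), z.2) : ℂ × ℂ)) := by
      refine Continuous.prodMk (Complex.continuous_conj.comp (by fun_prop)) continuous_const
    have := hc.tendsto (slope z)
    have e : slope z * d - z.1 * conj z.2 = conj z.1 := by
      simp only [slope]
      rw [← hdd, div_mul_cancel₀ _ hd]
      ring
    rwa [e, Complex.conj_conj] at this
  filter_upwards [hcont.eventually (Metric.ball_mem_nhds z hε)] with p hp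
  set y : ℂ × ℂ := (conj (p * d - z.1 * conj z.2), z.2) with hy
  have hy1 : conj y.1 = p * d - z.1 * conj z.2 := by simp [hy]
  have hy2 : conj y.2 = conj z.2 := rfl
  set l : ℂ → ℂ × ℂ := fun s => z + s • (-p, 1) with hl
  have hl0 : l 0 = z := by simp [hl]
  have hlc : Continuous l := by fun_prop
  have hld : HasDerivAt l (-p, 1) 0 := by
    have := ((hasDerivAt_id (0 : ℂ)).smul_const ((-p, 1) : ℂ × ℂ)).const_add z
    rwa [one_smul] at this
  have hcomp : ∀ {f : ℂ × ℂ → ℂ}, AnalyticOnNhd ℂ f U →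
      HasDerivAt (fun s => f (l s)) (fderiv ℂ f z (-p, 1)) 0 := by
    intro f hf
    have h : HasFDerivAt f (fderiv ℂ f z) (l 0) := by
      rw [hl0]
      exact (hf z hz).differentiableAt.hasFDerivAt
    exact h.comp_hasDerivAt 0 hld
  have hder := (((hcomp ha).mul_const p).add ((hcomp hA).mul_const (p ^ 2))).sub (hcomp hB)
  -- The conjugate of the polarized slope at `(y, z)`. Like `p`, it is unchanged when `z` moves
  -- along `l`, as `hN` and `hQ` verify.
  set q : ℂ := (z.1 + z.2 * conj y.1) / d with hq
  have hconst : (fun s => a (l s) * p + A (l s) * p ^ 2 - B (l s)) =ᶠ[𝓝 0]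
      fun _ => -(conj (a y) * q + conj (A y) * q ^ 2 - conj (B y)) := by
    have e1 : ∀ᶠ s in 𝓝 (0 : ℂ), l s ∈ Metric.ball z ε :=
      hlc.continuousAt.eventually (by rw [hl0]; exact Metric.ball_mem_nhds z hε)
    have e2 : ∀ᶠ s in 𝓝 (0 : ℂ), d - s * conj z.2 ≠ 0 := by
      have : Continuous fun s : ℂ => d - s * conj z.2 := by fun_prop
      exact this.continuousAt.eventually_ne (by simpa using hd)
    filter_upwards [e1, e2] with s hs1 hs2
    have hpol := polarForm_add_conj_eq_zero hdom ha hA hB htan Metric.isOpen_ball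
      (convex_ball z ε) hball hs1 hp
    have hD : 1 - (l s).2 * conj z.2 = d - s * conj z.2 := by
      simp [hl, hdd]
      ring
    have hN : conj y.1 + (l s).1 * conj z.2 = p * (d - s * conj z.2) := by
      rw [hy1]
      simp [hl]
      ring
    have hQ : (l s).1 + conj y.1 * (l s).2 = q * (d - s * conj z.2) := by
      rw [hq, div_mul_eq_mul_div, eq_div_iff hd, hy1]
      simp [hl, hdd]
      ring
    have hpol' : (d - s * conj z.2) ^ 2 * ((a (l s) * p + A (l s) * p ^ 2 - B (l s)) +
        (conj (a y) * q + conj (A y) * q ^ 2 - conj (B y))) = 0 := by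
      rw [← hpol]
      simp only [polarForm, map_add, map_sub, map_mul, map_pow, map_one, Complex.conj_conj, hy2]
      rw [mul_comm (conj z.2) (l s).2, hD, hN, hQ]
      ring
    have := (mul_eq_zero.1 hpol').resolve_left (pow_ne_zero 2 hs2)
    linear_combination this
  exact hder.unique ((hasDerivAt_const _ _).congr_of_eventuallyEq hconst)

/-- Expanding `levi_kernel_equation` gives a cubic in `p` that vanishes near `slope z`; these are
its four coefficients. -/
theorem differential_system (hdom : ∀ z ∈ U, 1 - z.2 * conj z.2 ≠ 0)
    (ha : AnalyticOnNhd ℂ a U) (hA : AnalyticOnNhd ℂ A U) (hB : AnalyticOnNhd ℂ B U)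
    (htan : ∀ z ∈ U, (a z * slope z + A z * slope z ^ 2 - B z).re = 0)
    {z : ℂ × ℂ} (hz : z ∈ U) :
    fderiv ℂ B z (0, 1) = 0 ∧ fderiv ℂ a z (0, 1) = -fderiv ℂ B z (1, 0) ∧
      fderiv ℂ A z (0, 1) = fderiv ℂ a z (1, 0) ∧ fderiv ℂ A z (1, 0) = 0 := by
  have h := levi_kernel_equation hdom ha hA hB htan hz
  obtain ⟨h0, h1, h2, h3⟩ := cubic_coeffs_eq_zero (x := slope z)
    (c₀ := -fderiv ℂ B z (0, 1)) (c₁ := fderiv ℂ a z (0, 1) + fderiv ℂ B z (1, 0))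
    (c₂ := fderiv ℂ A z (0, 1) - fderiv ℂ a z (1, 0)) (c₃ := -fderiv ℂ A z (1, 0)) (by
      filter_upwards [h] with p hp
      rw [fderiv_prod_apply (-p) 1, fderiv_prod_apply (-p) 1, fderiv_prod_apply (-p) 1] at hp
      linear_combination hp)
  exact ⟨neg_eq_zero.1 h0, eq_neg_of_add_eq_zero_left h1, sub_eq_zero.1 h2, neg_eq_zero.1 h3⟩

/-! ### Integration of the differential system -/

theorem analyticOnNhd_fderiv_apply {f : ℂ × ℂ → ℂ} (hf : AnalyticOnNhd ℂ f U) (v : ℂ × ℂ) :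
    AnalyticOnNhd ℂ (fun z => fderiv ℂ f z v) U := fun z hz =>
  ((ContinuousLinearMap.apply ℂ ℂ v).analyticAt _).comp (hf.fderiv z hz)

theorem fderiv_fderiv_comm {f : ℂ × ℂ → ℂ} (hf : AnalyticOnNhd ℂ f U) (v w : ℂ × ℂ)
    {z : ℂ × ℂ} (hz : z ∈ U) :
    fderiv ℂ (fun x => fderiv ℂ f x v) z w = fderiv ℂ (fun x => fderiv ℂ f x w) z v := by
  have hd : DifferentiableAt ℂ (fderiv ℂ f) z := (hf.fderiv z hz).differentiableAt
  have hs := (hf z hz).contDiffAt (n := ⊤) |>.isSymmSndFDerivAt_of_omega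
  rw [fderiv_clm_apply hd (differentiableAt_const v), fderiv_clm_apply hd (differentiableAt_const w)]
  simpa using hs w v

/-- Two holomorphic functions on a connected open set with the same partial derivatives differ by a
constant. -/
theorem exists_eq_add_const (hU : IsConnected (U : Set (ℂ × ℂ))) {f g : ℂ × ℂ → ℂ}
    (hf : AnalyticOnNhd ℂ f U) (hg : Differentiable ℂ g)
    (h1 : ∀ z ∈ U, fderiv ℂ f z (1, 0) = fderiv ℂ g z (1, 0))
    (h2 : ∀ z ∈ U, fderiv ℂ f z (0, 1) = fderiv ℂ g z (0, 1)) :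
    ∃ c, ∀ z ∈ U, f z = g z + c := by
  obtain ⟨c, hc⟩ := U.isOpen.exists_is_const_of_fderiv_eq_zero hU.isPreconnected
    (f := fun z => f z - g z) (hf.differentiableOn.sub hg.differentiableOn) (fun z hz => by
      have hfz := (hf z hz).differentiableAt
      refine (fderiv_fun_sub hfz (hg z)).trans ?_
      ext
      · simpa [sub_eq_zero] using h1 z hz
      · simpa [sub_eq_zero] using h2 z hz)
  exact ⟨c, fun z hz => by linear_combination hc z hz⟩

theorem fderiv_congr_on {f g : ℂ × ℂ → ℂ} (h : ∀ z ∈ U, f z = g z) {z : ℂ × ℂ} (hz : z ∈ U) :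
    fderiv ℂ f z = fderiv ℂ g z :=
  Filter.EventuallyEq.fderiv_eq (Filter.eventually_of_mem (U.isOpen.mem_nhds hz) h)

/-- The derivative of a quadratic polynomial in two variables. -/
theorem fderiv_quadratic (c₀ c₁ c₂ c₁₁ c₁₂ c₂₂ : ℂ) (z v : ℂ × ℂ) :
    fderiv ℂ (fun z : ℂ × ℂ => c₀ + c₁ * z.1 + c₂ * z.2 + c₁₁ * z.1 ^ 2 + c₁₂ * (z.1 * z.2)
      + c₂₂ * z.2 ^ 2) z v =
      c₁ * v.1 + c₂ * v.2 + 2 * c₁₁ * z.1 * v.1 + c₁₂ * (z.1 * v.2 + z.2 * v.1)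
        + 2 * c₂₂ * z.2 * v.2 := by
  have h1 : HasFDerivAt (fun z : ℂ × ℂ => z.1) _ z := hasFDerivAt_fst (𝕜 := ℂ)
  have h2 : HasFDerivAt (fun z : ℂ × ℂ => z.2) _ z := hasFDerivAt_snd (𝕜 := ℂ)
  have h := (((((h1.const_mul c₁).const_add c₀).add (h2.const_mul c₂)).add
    ((h1.pow 2).const_mul c₁₁)).add ((h1.mul h2).const_mul c₁₂)).add ((h2.pow 2).const_mul c₂₂)
  have h' := congrArg (fun L => L v) h.fderiv
  refine h'.trans ?_
  simp
  ring

end System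

section Integration

variable {U : Opens (ℂ × ℂ)} {a A B : ℂ × ℂ → ℂ}

theorem exists_eq_quadratic (hU : IsConnected (U : Set (ℂ × ℂ))) {f : ℂ × ℂ → ℂ}
    (hf : AnalyticOnNhd ℂ f U) {c₁ c₂ c₁₁ c₁₂ c₂₂ : ℂ}
    (h1 : ∀ z ∈ U, fderiv ℂ f z (1, 0) = c₁ + 2 * c₁₁ * z.1 + c₁₂ * z.2)
    (h2 : ∀ z ∈ U, fderiv ℂ f z (0, 1) = c₂ + c₁₂ * z.1 + 2 * c₂₂ * z.2) :
    ∃ c₀, ∀ z ∈ U, f z = c₀ + c₁ * z.1 + c₂ * z.2 + c₁₁ * z.1 ^ 2 + c₁₂ * (z.1 * z.2)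
      + c₂₂ * z.2 ^ 2 := by
  obtain ⟨c, hc⟩ := exists_eq_add_const hU hf
    (g := fun z : ℂ × ℂ => 0 + c₁ * z.1 + c₂ * z.2 + c₁₁ * z.1 ^ 2 + c₁₂ * (z.1 * z.2)
      + c₂₂ * z.2 ^ 2) (by fun_prop)
    (fun z hz => by rw [fderiv_quadratic, h1 z hz]; ring)
    (fun z hz => by rw [fderiv_quadratic, h2 z hz]; ring)
  exact ⟨c, fun z hz => by rw [hc z hz]; ring⟩

theorem solve_differential_system (hU : IsConnected (U : Set (ℂ × ℂ)))
    (ha : AnalyticOnNhd ℂ a U) (hA : AnalyticOnNhd ℂ A U) (hB : AnalyticOnNhd ℂ B U)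
    (hB2 : ∀ z ∈ U, fderiv ℂ B z (0, 1) = 0)
    (ha2 : ∀ z ∈ U, fderiv ℂ a z (0, 1) = -fderiv ℂ B z (1, 0))
    (hA2 : ∀ z ∈ U, fderiv ℂ A z (0, 1) = fderiv ℂ a z (1, 0))
    (hA1 : ∀ z ∈ U, fderiv ℂ A z (1, 0) = 0) :
    ∃ a₀ b₀ b₁ c₀ c₁ k : ℂ, ∀ z ∈ U,
      B z = b₀ + b₁ * z.1 - k * z.1 ^ 2 ∧ A z = c₀ + c₁ * z.2 + k * z.2 ^ 2 ∧
      a z = a₀ + c₁ * z.1 - b₁ * z.2 + 2 * k * (z.1 * z.2) := by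
  set β : ℂ × ℂ → ℂ := fun z => fderiv ℂ B z (1, 0) with hβ
  set γ : ℂ × ℂ → ℂ := fun z => fderiv ℂ A z (0, 1) with hγ
  have aβ : AnalyticOnNhd ℂ β U := analyticOnNhd_fderiv_apply hB _
  have aγ : AnalyticOnNhd ℂ γ U := analyticOnNhd_fderiv_apply hA _
  have zero_of : ∀ {f : ℂ × ℂ → ℂ}, (∀ z ∈ U, f z = 0) → ∀ z ∈ U, ∀ v, fderiv ℂ f z v = 0 := by
    intro f hf z hz v
    rw [fderiv_congr_on (g := fun _ => 0) hf hz]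
    simp
  have β2 : ∀ z ∈ U, fderiv ℂ β z (0, 1) = 0 := fun z hz => by
    rw [hβ, fderiv_fderiv_comm hB _ _ hz]
    exact zero_of hB2 z hz _
  have γ1 : ∀ z ∈ U, fderiv ℂ γ z (1, 0) = 0 := fun z hz => by
    rw [hγ, fderiv_fderiv_comm hA _ _ hz]
    exact zero_of hA1 z hz _
  have γ2 : ∀ z ∈ U, fderiv ℂ γ z (0, 1) = -fderiv ℂ β z (1, 0) := fun z hz => by
    rw [fderiv_congr_on hA2 hz, fderiv_fderiv_comm ha _ _ hz, fderiv_congr_on ha2 hz,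
      fderiv_fun_neg]
    rfl
  -- `γ` depends on `z₂` alone and `β` on `z₁` alone, so the common value of `γ_{z₂}` and `-β_{z₁}`
  -- is a constant `κ`.
  have aκ : AnalyticOnNhd ℂ (fun z => fderiv ℂ γ z (0, 1)) U := analyticOnNhd_fderiv_apply aγ _
  obtain ⟨κ, hκ⟩ := exists_eq_quadratic hU aκ (c₁ := 0) (c₂ := 0) (c₁₁ := 0) (c₁₂ := 0) (c₂₂ := 0)
    (fun z hz => by
      rw [fderiv_fderiv_comm aγ _ _ hz, zero_of γ1 z hz]
      ring)
    (fun z hz => by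
      rw [fderiv_congr_on γ2 hz, fderiv_fun_neg, neg_apply,
        fderiv_fderiv_comm aβ _ _ hz, zero_of β2 z hz]
      ring)
  obtain ⟨c₁, hc₁⟩ := exists_eq_quadratic hU aγ (c₁ := 0) (c₂ := κ) (c₁₁ := 0) (c₁₂ := 0)
    (c₂₂ := 0) (fun z hz => by rw [γ1 z hz]; ring) (fun z hz => by rw [hκ z hz]; ring)
  obtain ⟨b₁, hb₁⟩ := exists_eq_quadratic hU aβ (c₁ := -κ) (c₂ := 0) (c₁₁ := 0) (c₁₂ := 0)
    (c₂₂ := 0) (fun z hz => by linear_combination γ2 z hz - hκ z hz)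
    (fun z hz => by rw [β2 z hz]; ring)
  obtain ⟨b₀, hb₀⟩ := exists_eq_quadratic hU hB (c₁ := b₁) (c₂ := 0) (c₁₁ := -κ / 2) (c₁₂ := 0)
    (c₂₂ := 0) (fun z hz => by linear_combination hb₁ z hz)
    (fun z hz => by rw [hB2 z hz]; ring)
  obtain ⟨c₀, hc₀⟩ := exists_eq_quadratic hU hA (c₁ := 0) (c₂ := c₁) (c₁₁ := 0) (c₁₂ := 0)
    (c₂₂ := κ / 2) (fun z hz => by rw [hA1 z hz]; ring)
    (fun z hz => by linear_combination hc₁ z hz)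
  obtain ⟨a₀, ha₀⟩ := exists_eq_quadratic hU ha (c₁ := c₁) (c₂ := -b₁) (c₁₁ := 0) (c₁₂ := κ)
    (c₂₂ := 0) (fun z hz => by linear_combination hc₁ z hz - hA2 z hz)
    (fun z hz => by linear_combination ha2 z hz - hb₁ z hz)
  refine ⟨a₀, b₀, b₁, c₀, c₁, κ / 2, fun z hz => ⟨?_, ?_, ?_⟩⟩
  · rw [hb₀ z hz]; ring
  · rw [hc₀ z hz]; ring
  · rw [ha₀ z hz]; ring

/-- Solutions of the tangency equation. -/
theorem solve_tangency_equation (hU : IsConnected (U : Set (ℂ × ℂ)))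
    (hdom : ∀ z ∈ U, 1 - z.2 * conj z.2 ≠ 0)
    (ha : AnalyticOnNhd ℂ a U) (hA : AnalyticOnNhd ℂ A U) (hB : AnalyticOnNhd ℂ B U)
    (htan : ∀ z ∈ U, (a z * slope z + A z * slope z ^ 2 - B z).re = 0) :
    ∃ (τ c : ℝ) (b k : ℂ), ∀ z ∈ U,
      B z = Complex.I * τ - 2 * b * z.1 - k * z.1 ^ 2 ∧
      A z = 2 * Complex.I * c * z.2 - conj k + k * z.2 ^ 2 ∧
      a z = 2 * (Complex.I * c * z.1 + b * z.2 - conj b + k * (z.1 * z.2)) := by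
  have hsys := fun z (hz : z ∈ U) => differential_system hdom ha hA hB htan hz
  obtain ⟨a₀, b₀, b₁, c₀, c₁, k, hsol⟩ := solve_differential_system hU ha hA hB
    (fun z hz => (hsys z hz).1) (fun z hz => (hsys z hz).2.1) (fun z hz => (hsys z hz).2.2.1)
    (fun z hz => (hsys z hz).2.2.2)
  obtain ⟨z, hz⟩ := hU.nonempty
  have hd := hdom z hz
  -- With `z₂` fixed, use `p` itself as the coordinate: the point with `z₁ = conj p - z₂ p` has
  -- slope `p`.
  have htend : Filter.Tendsto (fun p : ℂ => ((conj p - z.2 * p, z.2) : ℂ × ℂ))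
      (𝓝 (slope z)) (𝓝 z) := by
    have hc : Continuous (fun p : ℂ => ((conj p - z.2 * p, z.2) : ℂ × ℂ)) :=
      (Complex.continuous_conj.sub (by fun_prop)).prodMk continuous_const
    have := hc.tendsto (slope z)
    rwa [conj_slope hd, add_sub_cancel_right] at this
  obtain ⟨hb, hn, hc, hm⟩ := real_quadratic_coeffs_eq_zero (b := -b₀) (n := a₀ - conj b₁)
    (c := c₁) (m := c₀ + conj k) (x := slope z) (by
      filter_upwards [htend.eventually (U.isOpen.mem_nhds hz)] with p hp
      have h := htan _ hp
      obtain ⟨e1, e2, e3⟩ := hsol _ hp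
      rw [slope_of_conj_sub hd, e1, e2, e3] at h
      -- The leftover terms have the form `ζ - conj ζ`, hence real part zero, and all dependence on
      -- `z₂` cancels.
      have e : (a₀ + c₁ * (conj p - z.2 * p) - b₁ * z.2 + 2 * k * ((conj p - z.2 * p) * z.2)) * p +
          (c₀ + c₁ * z.2 + k * z.2 ^ 2) * p ^ 2 -
          (b₀ + b₁ * (conj p - z.2 * p) - k * (conj p - z.2 * p) ^ 2) =
          (-b₀ + (a₀ - conj b₁) * p + c₁ * (p * conj p) + (c₀ + conj k) * p ^ 2) +
          ((conj b₁ * p - conj (conj b₁ * p)) + (conj (conj k * p ^ 2) - conj k * p ^ 2)) := by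
        simp only [map_mul, map_pow, Complex.conj_conj]
        ring
      dsimp only at h
      rw [e] at h
      simp only [Complex.add_re, Complex.sub_re, Complex.conj_re, sub_self, add_zero] at h ⊢
      exact h)
  have hb₀ : b₀ = Complex.I * (b₀.im : ℂ) := Complex.ext (by simpa using hb) (by simp)
  have hc₁ : c₁ = 2 * Complex.I * ((c₁.im / 2 : ℝ) : ℂ) := Complex.ext (by simpa using hc) (by
    simp
    ring)
  have ha₀ : a₀ = conj b₁ := sub_eq_zero.1 hn
  have hc₀ : c₀ = -conj k := eq_neg_of_add_eq_zero_left hm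
  refine ⟨b₀.im, c₁.im / 2, -b₁ / 2, k, fun z hz => ?_⟩
  obtain ⟨e1, e2, e3⟩ := hsol z hz
  refine ⟨?_, ?_, ?_⟩
  · rw [e1, ← hb₀]
    ring
  · rw [e2, hc₀, ← hc₁]
    ring
  · rw [e3, ha₀]
    simp only [map_div₀, map_neg, map_ofNat]
    linear_combination z.1 * hc₁

end Integration

/-! ### The seven-parameter family -/

/-- The coefficients of the combination `∑ θᵢ Xⁱ` of the seven fields. -/
def combCoeff (θ : Fin 7 → ℝ) (p : C3) : C3 :=
  (((θ 1 + θ 2 * Complex.I) * p.1.1 + (θ 3 + θ 4 * Complex.I) * p.1.2 - (θ 3 - θ 4 * Complex.I)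
      + (θ 5 + θ 6 * Complex.I) * (p.1.1 * p.1.2),
    2 * θ 2 * Complex.I * p.1.2 - (θ 5 - θ 6 * Complex.I)
      + (θ 5 + θ 6 * Complex.I) * p.1.2 ^ 2),
    θ 0 * Complex.I + 2 * θ 1 * p.2 - 2 * (θ 3 + θ 4 * Complex.I) * p.1.1
      - (θ 5 + θ 6 * Complex.I) * p.1.1 ^ 2)

theorem sum_smul_modelField_apply {U : Opens (ℂ × ℂ)} (θ : Fin 7 → ℝ) {p : C3}
    (hp : p ∈ cylinder U) : (∑ i, θ i • modelField U i).1 p = combCoeff θ p := by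
  have h : ∀ i, (modelField U i).1 p = modelCoeff i p := fun i => HolVF.mk_apply hp
  rw [Submodule.coe_sum, Finset.sum_apply]
  simp only [Submodule.coe_smul, Pi.smul_apply, h]
  rw [Fin.sum_univ_seven]
  refine Prod.ext (Prod.ext ?_ ?_) ?_ <;> simp [modelCoeff, combCoeff] <;> ring

theorem fderiv_combCoeff (θ : Fin 7 → ℝ) (p v : C3) :
    fderiv ℂ (combCoeff θ) p v =
      (((θ 1 + θ 2 * Complex.I) * v.1.1 + (θ 3 + θ 4 * Complex.I) * v.1.2
          + (θ 5 + θ 6 * Complex.I) * (p.1.1 * v.1.2 + p.1.2 * v.1.1),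
        2 * θ 2 * Complex.I * v.1.2 + 2 * (θ 5 + θ 6 * Complex.I) * p.1.2 * v.1.2),
        2 * θ 1 * v.2 - 2 * (θ 3 + θ 4 * Complex.I) * v.1.1
          - 2 * (θ 5 + θ 6 * Complex.I) * p.1.1 * v.1.1) := by
  have hf : HasFDerivAt (fun p : C3 => p.1) _ p := hasFDerivAt_fst (𝕜 := ℂ)
  have h1 : HasFDerivAt (fun p : C3 => p.1.1) _ p := hf.fst
  have h2 : HasFDerivAt (fun p : C3 => p.1.2) _ p := hf.snd
  have h3 : HasFDerivAt (fun p : C3 => p.2) _ p := hasFDerivAt_snd (𝕜 := ℂ)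
  have hA1 := (((h1.const_mul (θ 1 + θ 2 * Complex.I : ℂ)).add
    (h2.const_mul (θ 3 + θ 4 * Complex.I : ℂ))).sub_const (θ 3 - θ 4 * Complex.I : ℂ)).add
    ((h1.mul h2).const_mul (θ 5 + θ 6 * Complex.I : ℂ))
  have hA2 := ((h2.const_mul (2 * θ 2 * Complex.I : ℂ)).sub_const (θ 5 - θ 6 * Complex.I : ℂ)).add
    ((h2.pow 2).const_mul (θ 5 + θ 6 * Complex.I : ℂ))
  have hB := (((h3.const_mul (2 * θ 1 : ℂ)).const_add (θ 0 * Complex.I : ℂ)).sub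
    (h1.const_mul (2 * (θ 3 + θ 4 * Complex.I) : ℂ))).sub
    ((h1.pow 2).const_mul (θ 5 + θ 6 * Complex.I : ℂ))
  have h' := congrArg (fun L => L v) ((hA1.prodMk hA2).prodMk hB).fderiv
  refine h'.trans ?_
  refine Prod.ext (Prod.ext ?_ ?_) ?_ <;> simp <;> ring

/-- The fields `∑ θᵢ Xⁱ` satisfy the tangency equation. -/
theorem re_combCoeff (θ : Fin 7 → ℝ) (s z₂ w : ℂ) :
    (2 * s * (combCoeff θ ((conj s - z₂ * s, z₂), w)).1.1
      + s ^ 2 * (combCoeff θ ((conj s - z₂ * s, z₂), w)).1.2).re =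
      (combCoeff θ ((conj s - z₂ * s, z₂), w)).2.re
        + 2 * θ 1 * (((conj s - z₂ * s) * s).re - w.re) := by
  simp [combCoeff, pow_two]
  ring

/-- The Lie bracket in the coordinates given by the seven fields. -/
def combBracket (θ η : Fin 7 → ℝ) : Fin 7 → ℝ :=
  ![2 * (η 1 * θ 0 - θ 1 * η 0) + 4 * (η 4 * θ 3 - η 3 * θ 4),
    0,
    2 * (θ 6 * η 5 - θ 5 * η 6),
    η 1 * θ 3 + η 2 * θ 4 + (η 3 * θ 5 + η 4 * θ 6) - θ 1 * η 3 - θ 2 * η 4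
      - (θ 3 * η 5 + θ 4 * η 6),
    η 1 * θ 4 - η 2 * θ 3 + (η 3 * θ 6 - η 4 * θ 5) - θ 1 * η 4 + θ 2 * η 3
      - (θ 3 * η 6 - θ 4 * η 5),
    -2 * (θ 2 * η 6 - η 2 * θ 6),
    2 * (θ 2 * η 5 - η 2 * θ 5)]

theorem lieBracket_combCoeff (θ η : Fin 7 → ℝ) (p : C3) :
    VectorField.lieBracket ℂ (combCoeff θ) (combCoeff η) p = combCoeff (combBracket θ η) p := by
  have hI : Complex.I ^ 2 = -1 := Complex.I_sq
  unfold VectorField.lieBracket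
  rw [fderiv_combCoeff, fderiv_combCoeff]
  refine Prod.ext (Prod.ext ?_ ?_) ?_
  · simp [combCoeff, combBracket]
    ring_nf
    simp only [hI]
    ring
  · simp [combCoeff, combBracket]
    ring_nf
    simp only [hI]
    ring
  · simp [combCoeff, combBracket]
    ring_nf
    simp only [hI]
    ring

/-! ### Span of the fields: Lie closure, independence, equality with the tangent fields -/

theorem mem_span_modelField_iff {U : Opens (ℂ × ℂ)} {X : HolVF (cylinder U)} :
    X ∈ Submodule.span ℝ (Set.range (modelField U)) ↔
      ∃ θ : Fin 7 → ℝ, ∀ p ∈ cylinder U, X.1 p = combCoeff θ p := by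
  rw [Submodule.mem_span_range_iff_exists_fun]
  refine exists_congr fun θ => ⟨?_, fun h => ?_⟩
  · rintro rfl p hp
    exact sum_smul_modelField_apply θ hp
  · exact HolVF.ext_on fun p hp => by rw [sum_smul_modelField_apply θ hp, h p hp]

theorem lie_mem_span_modelField {U : Opens (ℂ × ℂ)} {X Y : HolVF (cylinder U)}
    (hX : X ∈ Submodule.span ℝ (Set.range (modelField U)))
    (hY : Y ∈ Submodule.span ℝ (Set.range (modelField U))) :
    ⁅X, Y⁆ ∈ Submodule.span ℝ (Set.range (modelField U)) := by
  rw [mem_span_modelField_iff] at hX hY ⊢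
  obtain ⟨θ, hθ⟩ := hX
  obtain ⟨η, hη⟩ := hY
  refine ⟨combBracket θ η, fun p hp => ?_⟩
  have hn := (cylinder U).isOpen.mem_nhds hp
  rw [HolVF.bracket_apply X Y hp,
    Filter.EventuallyEq.lieBracket_vectorField_eq (Filter.eventually_of_mem hn hθ)
      (Filter.eventually_of_mem hn hη), lieBracket_combCoeff]

theorem linearIndependent_modelField {U : Opens (ℂ × ℂ)} (hU : (U : Set (ℂ × ℂ)).Nonempty) :
    LinearIndependent ℝ (modelField U) := by
  rw [Fintype.linearIndependent_iff]
  intro θ hθ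
  have hzero : ∀ z ∈ U, ∀ w : ℂ, combCoeff θ (z, w) = 0 := fun z hz w => by
    have hp : (z, w) ∈ cylinder U := ⟨hz, trivial⟩
    rw [← sum_smul_modelField_apply θ hp, hθ]
    rfl
  obtain ⟨z, hz⟩ := hU
  -- Only `X²` involves `w`. Once it is removed, the `∂_w` coefficient is a polynomial in `z₁` that
  -- detects everything but `θ 2`, which is read off from `∂_{z₂}`.
  have h1 : θ 1 = 0 := by
    have e0 := congrArg Prod.snd (hzero z hz 0)
    have e1 := congrArg Prod.snd (hzero z hz 1)
    simp only [combCoeff, Prod.snd_zero] at e0 e1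
    have : (θ 1 : ℂ) = 0 := by linear_combination (e1 - e0) / 2
    exact_mod_cast this
  have t1 : ∀ᶠ x in 𝓝 z.1, (x, z.2) ∈ U := by
    have hc : Continuous fun x : ℂ => ((x, z.2) : ℂ × ℂ) := by fun_prop
    exact hc.continuousAt.eventually (U.isOpen.mem_nhds hz)
  have t2 : ∀ᶠ y in 𝓝 z.2, (z.1, y) ∈ U := by
    have hc : Continuous fun y : ℂ => ((z.1, y) : ℂ × ℂ) := by fun_prop
    exact hc.continuousAt.eventually (U.isOpen.mem_nhds hz)
  obtain ⟨f0, f1, f2⟩ := quadratic_coeffs_eq_zero (x := z.1) (c₀ := (θ 0 * Complex.I : ℂ))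
    (c₁ := -2 * (θ 3 + θ 4 * Complex.I)) (c₂ := -(θ 5 + θ 6 * Complex.I)) (by
      filter_upwards [t1] with x hx
      have e := congrArg Prod.snd (hzero _ hx 0)
      simp only [combCoeff, Prod.snd_zero] at e
      linear_combination e)
  obtain ⟨-, g1, -⟩ := quadratic_coeffs_eq_zero (x := z.2) (c₀ := -(θ 5 - θ 6 * Complex.I : ℂ))
    (c₁ := 2 * θ 2 * Complex.I) (c₂ := (θ 5 + θ 6 * Complex.I)) (by
      filter_upwards [t2] with y hy
      have e := congrArg (fun p : C3 => p.1.2) (hzero _ hy 0)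
      simp only [combCoeff, Prod.snd_zero, Prod.fst_zero] at e
      linear_combination e)
  have f0' := congrArg Complex.im f0
  have f1r := congrArg Complex.re f1
  have f1i := congrArg Complex.im f1
  have f2r := congrArg Complex.re f2
  have f2i := congrArg Complex.im f2
  have g1i := congrArg Complex.im g1
  simp at f0' f1r f1i f2r f2i g1i
  intro i
  fin_cases i <;> assumption

theorem span_modelField_eq_holRigid {U : Opens (ℂ × ℂ)} (hU : IsConnected (U : Set (ℂ × ℂ)))
    (hdom : ∀ z ∈ U, 1 - z.2 * conj z.2 ≠ 0) :
    (Submodule.span ℝ (Set.range (modelField U)) : Set (HolVF (cylinder U))) =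
      holRigid U modelF := by
  ext X
  rw [SetLike.mem_coe, mem_span_modelField_iff]
  constructor
  · rintro ⟨θ, hθ⟩
    have hcd : ContDiff ℂ ⊤ fun z : ℂ × ℂ => combCoeff θ (z, 0) := by
      unfold combCoeff
      fun_prop
    refine ⟨⟨fun z => (combCoeff θ (z, 0)).1.1, fun z => (combCoeff θ (z, 0)).1.2,
      fun z => (combCoeff θ (z, 0)).2, 2 * θ 1, ?_, ?_, ?_, fun p hp => ?_⟩, ?_⟩
    · exact fun z _ => (hcd.fst.fst.contDiffAt (x := z)).analyticAt
    · exact fun z _ => (hcd.fst.snd.contDiffAt (x := z)).analyticAt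
    · exact fun z _ => (hcd.snd.contDiffAt (x := z)).analyticAt
    · rw [hθ p hp]
      refine Prod.ext (Prod.ext ?_ ?_) ?_ <;> simp [combCoeff]
      ring
    · rintro p ⟨hpU, hpF⟩
      have hd := hdom _ hpU
      rw [mem_tangentSpaceAt_iff hd, hθ p ⟨hpU, trivial⟩]
      -- Brings `p` to the form required by `re_combCoeff`, whose error term `2 θ₁ (F - u)` vanishes
      -- on the hypersurface.
      have h1 : p = ((conj (slope p.1) - p.1.2 * slope p.1, p.1.2), p.2) := by
        rw [conj_slope hd, add_sub_cancel_right]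
      have h := re_combCoeff θ (slope p.1) p.1.2 p.2
      rw [← h1, conj_slope hd, add_sub_cancel_right, hpF, modelF_eq_re hd] at h
      linear_combination -h
  · rintro ⟨⟨A₁, A₂, B, α, hA₁, hA₂, hB, hX⟩, htan⟩
    have ha : AnalyticOnNhd ℂ (fun z => 2 * A₁ z - α * z.1) U :=
      (analyticOnNhd_const.mul hA₁).sub (analyticOnNhd_const.mul analyticOnNhd_fst)
    obtain ⟨τ, c, b, k, hsol⟩ := solve_tangency_equation hU hdom ha hA₂ hB (fun z hz => by
      -- One point over each `z` suffices: `α` is real, so the condition does not involve `Im w`.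
      have h := htan (z, (modelF z : ℂ)) ⟨hz, by simp⟩
      rw [mem_tangentSpaceAt_iff (hdom z hz), hX _ ⟨hz, trivial⟩] at h
      dsimp only at h
      rw [Complex.add_re, Complex.re_ofReal_mul, Complex.ofReal_re, modelF_eq_re (hdom z hz),
        ← Complex.re_ofReal_mul] at h
      have e : (2 * A₁ z - α * z.1) * slope z + A₂ z * slope z ^ 2 - B z =
        (2 * slope z * A₁ z + slope z ^ 2 * A₂ z) - α * (z.1 * slope z) - B z := by ring
      rw [e, Complex.sub_re, Complex.sub_re, ← h]
      ring)
    -- `α / 2` because `X²` carries `2w`; `b` and `k` split into the coefficients of the pairs `X⁴,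
    -- X⁵` and `X⁶, X⁷`.
    refine ⟨![τ, α / 2, c, b.re, b.im, k.re, k.im], fun p hp => ?_⟩
    obtain ⟨e1, e2, e3⟩ := hsol p.1 hp.1
    have hb := Complex.re_add_im b
    have hk := Complex.re_add_im k
    have hb' : (b.re - b.im * Complex.I : ℂ) = conj b := by
      apply Complex.ext <;> simp
    have hk' : (k.re - k.im * Complex.I : ℂ) = conj k := by
      apply Complex.ext <;> simp
    rw [hX p hp, e1, e2]
    refine Prod.ext (Prod.ext ?_ ?_) ?_ <;> simp [combCoeff, hb, hk, hb', hk']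
    · linear_combination e3 / 2
    · exact Or.inl (by ring)
    · ring

end RigidCR

end

theorem proposition1p1 (U : TopologicalSpace.Opens (ℂ × ℂ))
    (hconn : IsConnected (U : Set (ℂ × ℂ)))
    (hdom : ∀ z ∈ U, 1 - z.2 * (starRingEnd ℂ) z.2 ≠ 0) :
    ∃ h : LieSubalgebra ℝ (RigidCR.HolVF (RigidCR.cylinder U)),
      (h : Set (RigidCR.HolVF (RigidCR.cylinder U))) = RigidCR.holRigid U RigidCR.modelF ∧
      Module.finrank ℝ h = 7 ∧
      LinearIndependent ℝ (RigidCR.modelField U) ∧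
      Submodule.span ℝ (Set.range (RigidCR.modelField U)) = h.toSubmodule := by
  have hli := RigidCR.linearIndependent_modelField hconn.nonempty
  refine ⟨{ Submodule.span ℝ (Set.range (RigidCR.modelField U)) with
    lie_mem' := fun hX hY => RigidCR.lie_mem_span_modelField hX hY },
    RigidCR.span_modelField_eq_holRigid hconn hdom, ?_, hli, rfl⟩
  exact (finrank_span_eq_card hli).trans (Fintype.card_fin 7)
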